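/- Theorem 2.1. Let $S=(-1,1)^2$. For a real polynomial $u=u(\xi,\eta)$ put $$\mathcal B(u)=\|u\|_{H^4(S)}^2=\int_S\sum_{|\alpha|\le 4}\left|D^{\alpha}_{\xi,\eta}u\right|^2\,d\xi\,d\eta ,$$ where the sum runs over all multi-indices $\alpha=(\alpha_1,\alpha_2)$ of non-negative integers with $|\alpha|=\alpha_1+\alpha_2\le 4$ and $D^{\alpha}_{\xi,\eta}=\partial_\xi^{\alpha_1}\partial_\eta^{\alpha_2}$, and $$\mathcal C(u)=\int_S\left(u_{\xi\xi\xi\xi}^2+u_{\eta\eta\eta\eta}^2+u_{\xi\xi\xi}^2+u_{\eta\eta\eta}^2+u_{\xi\xi}^2+u_{\eta\eta}^2+u_{\xi}^2+u_{\eta}^2+u^2\right)d\xi\,d\eta .$$ Then $\mathcal B$ and $\mathcal C$ are spectrally equivalent, uniformly in the polynomial degree: there is a constant $M>0$ such that, for every integer $W\ge 0$ and every real polynomial $u(\xi,\eta)$ of degree at most $W$ in $\xi$ and at most $W$ in $\eta$, $$\frac1M\,\mathcal B(u)\le \mathcal C(u)\le \mathcal B(u).$$ -/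

import Mathlib

open MeasureTheory

namespace SpectralForms

/-- The open reference square `S = (-1,1) × (-1,1)`. -/
def S : Set (ℝ × ℝ) := Set.Ioo (-1) 1 ×ˢ Set.Ioo (-1) 1

/-- The function `(ξ, η) ↦ u(ξ, η)` of a real polynomial in two variables
(variable `0` is `ξ`, variable `1` is `η`). -/
noncomputable def toFun (u : MvPolynomial (Fin 2) ℝ) (p : ℝ × ℝ) : ℝ :=
  MvPolynomial.eval ![p.1, p.2] u

/-- The partial derivative `∂_ξ^i ∂_η^j f` of a function of two real variables. -/
noncomputable def partialDeriv (i j : ℕ) (f : ℝ × ℝ → ℝ) (p : ℝ × ℝ) : ℝ :=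
  iteratedDeriv i (fun ξ => iteratedDeriv j (fun η => f (ξ, η)) p.2) p.1

/-- The multi-indices `α = (α₁, α₂)` with `|α| = α₁ + α₂ ≤ 4`. -/
def multiIndices : Finset (ℕ × ℕ) :=
  (Finset.range 5 ×ˢ Finset.range 5).filter fun α => α.1 + α.2 ≤ 4

/-- `‖f‖²_{H⁴(S)} = ∫_S ∑_{|α| ≤ 4} |D^α f|²`. It is used here only for polynomials,
for which the weak derivatives are the classical ones. -/
noncomputable def formB (f : ℝ × ℝ → ℝ) : ℝ :=
  ∫ p in S, ∑ α ∈ multiIndices, |partialDeriv α.1 α.2 f p| ^ 2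

/-- The separable form: only the pure derivatives of orders `0, …, 4` occur. -/
noncomputable def formC (f : ℝ × ℝ → ℝ) : ℝ :=
  ∫ p in S,
    (partialDeriv 4 0 f p ^ 2 + partialDeriv 0 4 f p ^ 2
      + partialDeriv 3 0 f p ^ 2 + partialDeriv 0 3 f p ^ 2
      + partialDeriv 2 0 f p ^ 2 + partialDeriv 0 2 f p ^ 2
      + partialDeriv 1 0 f p ^ 2 + partialDeriv 0 1 f p ^ 2
      + f p ^ 2)

end SpectralForms

/-!
Only the bound `formB ≤ M * formC` has content: the mixed derivatives have to be controlled by the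
pure ones, on a square and without boundary conditions.

The heart of the matter is the second-order estimate `exists_sqNorm_mixed_le`,
`‖P_ξη‖² ≤ K (δ (‖P‖² + ‖P_ξξ‖²) + δ⁻¹ (‖P‖² + ‖P_ηη‖²))` for every `δ > 0`.
If boundary terms were absent, it would follow from `∫ P_ξη² = ∫ P_ξξ P_ηη`. To remove them, in each
variable the derivative `h` is tested by three weighted forms
`∫ w_e (h(x) - e² h((3e + x)/4))² dx`, `e ∈ {-1, 0, 1}`. For `e = 0` this is `∫ (1 - x²) h²`, whose
weight vanishes at both ends. For `e = ±1` the weight vanishes at the end `-e`, and the difference of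
`h` with its contraction towards the end `e` vanishes at `e`. So no form sees the boundary, and if
`h = f'`, the difference is itself the derivative of `f - 4 e² f((3e + x)/4)`. Yet together
the forms control `∫ h²` (`integral_sq_le_weighted`): contraction by the factor `4` doubles the `L²`
norm of `h` near the end, so there the difference cannot be small while `h` is large.
Applying this in both variables and integrating by parts twice (`sqInt_weight_mul_mixed_sq`)
gives the estimate, the lower-order terms being removed by the interpolation inequality
`sqNorm_pderiv_le`, which has the same proof in one variable.

The fourth-order theorem follows algebraically in `exists_formB_le`. The estimate for `u_ξξ` and
`u_ηη` bounds `‖u_ξξξη‖²` and `‖u_ξηηη‖²` by `formC` and a small multiple of `‖u_ξξηη‖²`, the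
estimate for `u_ξη` bounds `‖u_ξξηη‖²` by those two and `‖u_ξη‖²`, and the small multiple is absorbed.
None of the constants depends on the degree.
-/

namespace SpectralForms

open MvPolynomial

/-! ### Integration of polynomials over the square -/

/-- The point of the plane whose coordinate of index `i` is `x` and whose other coordinate is
`t`. Slicing along either coordinate direction lets both variables be treated at once. -/
def slice (i : Fin 2) (x t : ℝ) : Fin 2 → ℝ := fun j => if j = i then x else t

lemma update_slice (i : Fin 2) (x y t : ℝ) :
    Function.update (slice i x t) i y = slice i y t := by
  funext j
  by_cases h : j = i
  · subst h; simp [slice]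
  · simp [slice, h]

lemma slice_zero (x t : ℝ) : slice 0 x t = ![x, t] := by
  funext j; fin_cases j <;> simp [slice]

lemma slice_one (x t : ℝ) : slice 1 x t = ![t, x] := by
  funext j; fin_cases j <;> simp [slice]

lemma slice_swap {i j : Fin 2} (h : j ≠ i) (x t : ℝ) : slice i x t = slice j t x := by
  funext k
  simp only [slice]
  split_ifs <;> first | rfl | omega

lemma continuous_slice (i : Fin 2) : Continuous fun p : ℝ × ℝ => slice i p.1 p.2 := by
  refine continuous_pi fun j => ?_
  by_cases h : j = i <;> simp only [slice, h, if_true, if_false] <;> fun_prop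

lemma continuous_eval_slice (i : Fin 2) (P : MvPolynomial (Fin 2) ℝ) :
    Continuous fun p : ℝ × ℝ => eval (slice i p.1 p.2) P :=
  (continuous_eval P).comp (continuous_slice i)

lemma continuous_eval_slice_left (i : Fin 2) (P : MvPolynomial (Fin 2) ℝ) (t : ℝ) :
    Continuous fun x : ℝ => eval (slice i x t) P :=
  (continuous_eval P).comp <| (continuous_slice i).comp (Continuous.prodMk_left t)

lemma hasDerivAt_eval_slice (i : Fin 2) (P : MvPolynomial (Fin 2) ℝ) (x t : ℝ) :
    HasDerivAt (fun x => eval (slice i x t) P) (eval (slice i x t) (pderiv i P)) x := by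
  induction P using MvPolynomial.induction_on with
  | C a => simpa using hasDerivAt_const x a
  | add p q hp hq =>
    simp only [map_add]
    exact hp.fun_add hq
  | mul_X p j hp =>
    have hX : HasDerivAt (fun x => slice i x t j) (if j = i then 1 else 0) x := by
      by_cases h : j = i
      · simp only [slice, h, if_true]
        exact hasDerivAt_id' x
      · simp only [slice, h, if_false]
        exact hasDerivAt_const x t
    simp only [map_mul, eval_X, pderiv_mul, pderiv_X, map_add]
    have hXe : eval (slice i x t) ((Pi.single i 1 : Fin 2 → MvPolynomial (Fin 2) ℝ) j)
        = if j = i then 1 else 0 := by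
      by_cases h : j = i
      · subst h; simp
      · simp [h]
    rw [hXe]
    exact hp.fun_mul hX

lemma pderiv_comm (i j : Fin 2) (P : MvPolynomial (Fin 2) ℝ) :
    pderiv i (pderiv j P) = pderiv j (pderiv i P) := by
  induction P using MvPolynomial.induction_on with
  | C a => simp
  | add p q hp hq => simp [hp, hq]
  | mul_X p k hp =>
    simp only [pderiv_mul, pderiv_X, map_add, hp]
    have h (a b : Fin 2) : pderiv a
        ((Pi.single b 1 : Fin 2 → MvPolynomial (Fin 2) ℝ) k) = 0 := by
      by_cases hk : k = b
      · subst hk; simp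
      · simp [hk]
    rw [h, h]
    ring

lemma measurableSet_S : MeasurableSet S := measurableSet_Ioo.prod measurableSet_Ioo

lemma integrableOn_S {f : ℝ × ℝ → ℝ} (hf : Continuous f) : IntegrableOn f S := by
  have : IntegrableOn f (Set.Icc (-1) 1 ×ˢ Set.Icc (-1) 1) :=
    hf.continuousOn.integrableOn_compact (isCompact_Icc.prod isCompact_Icc)
  exact this.mono_set (Set.prod_mono Set.Ioo_subset_Icc_self Set.Ioo_subset_Icc_self)

lemma setIntegral_S_eq {f : ℝ × ℝ → ℝ} (hf : Continuous f) :
    ∫ p in S, f p = ∫ x in (-1 : ℝ)..1, ∫ y in (-1 : ℝ)..1, f (x, y) := by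
  rw [S, Measure.volume_eq_prod, setIntegral_prod]
  · simp only [intervalIntegral.integral_of_le (by norm_num : (-1 : ℝ) ≤ 1),
      integral_Ioc_eq_integral_Ioo]
  · exact integrableOn_S hf

lemma setIntegral_S_swap (f : ℝ × ℝ → ℝ) :
    ∫ p in S, f p.swap = ∫ p in S, f p := by
  rw [S, Measure.volume_eq_prod]
  exact setIntegral_prod_swap _ _ f

/-- The integral of a polynomial over the square `S`. -/
noncomputable def sqInt (P : MvPolynomial (Fin 2) ℝ) : ℝ := ∫ p in S, toFun P p

/-- The squared `L²(S)` norm of a polynomial. -/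
noncomputable def sqNorm (P : MvPolynomial (Fin 2) ℝ) : ℝ := sqInt (P ^ 2)

lemma continuous_toFun (P : MvPolynomial (Fin 2) ℝ) : Continuous (toFun P) := by
  have := continuous_eval_slice 0 P
  simp only [slice_zero] at this
  exact this

lemma sqInt_eq_slice (i : Fin 2) (P : MvPolynomial (Fin 2) ℝ) :
    sqInt P = ∫ t in (-1 : ℝ)..1, ∫ x in (-1 : ℝ)..1, eval (slice i x t) P := by
  fin_cases i
  · change _ = ∫ t in (-1 : ℝ)..1, ∫ x in (-1 : ℝ)..1, eval (slice 0 x t) P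
    simp only [slice_zero]
    rw [sqInt, ← setIntegral_S_swap]
    exact setIntegral_S_eq ((continuous_toFun P).comp continuous_swap)
  · change _ = ∫ t in (-1 : ℝ)..1, ∫ x in (-1 : ℝ)..1, eval (slice 1 x t) P
    simp only [slice_one]
    exact setIntegral_S_eq (continuous_toFun P)

lemma sqInt_add (P Q : MvPolynomial (Fin 2) ℝ) : sqInt (P + Q) = sqInt P + sqInt Q := by
  unfold sqInt
  rw [← integral_add (integrableOn_S (continuous_toFun P)) (integrableOn_S (continuous_toFun Q))]
  simp [toFun]

lemma sqInt_C_mul (c : ℝ) (P : MvPolynomial (Fin 2) ℝ) : sqInt (C c * P) = c * sqInt P := by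
  unfold sqInt
  rw [← integral_const_mul]
  simp [toFun]

lemma sqInt_mono {P Q : MvPolynomial (Fin 2) ℝ} (i : Fin 2)
    (h : ∀ x ∈ Set.Icc (-1 : ℝ) 1, ∀ t ∈ Set.Icc (-1 : ℝ) 1,
      eval (slice i x t) P ≤ eval (slice i x t) Q) : sqInt P ≤ sqInt Q := by
  refine setIntegral_mono_on (integrableOn_S (continuous_toFun P))
    (integrableOn_S (continuous_toFun Q)) measurableSet_S ?_
  intro p hp
  have hx : p.1 ∈ Set.Icc (-1 : ℝ) 1 := Set.Ioo_subset_Icc_self hp.1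
  have hy : p.2 ∈ Set.Icc (-1 : ℝ) 1 := Set.Ioo_subset_Icc_self hp.2
  have h0 : i = 0 ∨ i = 1 := by omega
  rcases h0 with h0 | h0
  · have := h p.1 hx p.2 hy
    rw [h0, slice_zero] at this
    exact this
  · have := h p.2 hy p.1 hx
    rw [h0, slice_one] at this
    exact this

lemma sqNorm_nonneg (P : MvPolynomial (Fin 2) ℝ) : 0 ≤ sqNorm P :=
  setIntegral_nonneg measurableSet_S fun p _ => by simpa [toFun] using sq_nonneg _

/-- An inequality between the inner integrals along the coordinate direction `i` can be
integrated over the remaining variable. -/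
lemma sqInt_le_of_slice (i : Fin 2) {P Q : MvPolynomial (Fin 2) ℝ}
    (h : ∀ t ∈ Set.Icc (-1 : ℝ) 1, ∫ x in (-1 : ℝ)..1, eval (slice i x t) P
      ≤ ∫ x in (-1 : ℝ)..1, eval (slice i x t) Q) : sqInt P ≤ sqInt Q := by
  have hc (R : MvPolynomial (Fin 2) ℝ) :
      Continuous fun t : ℝ => ∫ x in (-1 : ℝ)..1, eval (slice i x t) R := by
    have hk : Continuous (Function.uncurry fun t x : ℝ => eval (slice i x t) R) :=
      (continuous_eval R).comp ((continuous_slice i).comp continuous_swap)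
    exact intervalIntegral.continuous_parametric_intervalIntegral_of_continuous' hk _ _
  rw [sqInt_eq_slice i, sqInt_eq_slice i]
  exact intervalIntegral.integral_mono_on (by norm_num) ((hc P).intervalIntegrable _ _)
    ((hc Q).intervalIntegrable _ _) h

/-- Integration by parts in the variable `i`, without boundary terms. -/
lemma sqInt_pderiv_mul (i : Fin 2) {F : MvPolynomial (Fin 2) ℝ} (G : MvPolynomial (Fin 2) ℝ)
    (h₁ : ∀ t, eval (slice i 1 t) F = 0) (h₂ : ∀ t, eval (slice i (-1) t) F = 0) :
    sqInt (F * pderiv i G) = -sqInt (pderiv i F * G) := by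
  rw [sqInt_eq_slice i, sqInt_eq_slice i, ← intervalIntegral.integral_neg]
  congr 1
  funext t
  simp only [map_mul]
  rw [intervalIntegral.integral_mul_deriv_eq_deriv_mul
    (fun x _ => hasDerivAt_eval_slice i F x t) (fun x _ => hasDerivAt_eval_slice i G x t)
    ((continuous_eval_slice_left i _ t).intervalIntegrable _ _)
    ((continuous_eval_slice_left i _ t).intervalIntegrable _ _), h₁, h₂]
  ring

/-- The weighted arithmetic-geometric form of the Cauchy-Schwarz inequality in `L²(S)`. -/
lemma sqInt_mul_le (P Q : MvPolynomial (Fin 2) ℝ) {δ : ℝ} (hδ : 0 < δ) :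
    sqInt (P * Q) ≤ δ * sqNorm P + δ⁻¹ * sqNorm Q := by
  unfold sqNorm
  rw [← sqInt_C_mul, ← sqInt_C_mul, ← sqInt_add]
  refine sqInt_mono 0 fun x _ t _ => ?_
  simp only [map_mul, map_add, map_pow, eval_C]
  set a := eval (slice 0 x t) P
  set b := eval (slice 0 x t) Q
  have h : δ * a ^ 2 + δ⁻¹ * b ^ 2 - a * b = δ * (a - δ⁻¹ * b / 2) ^ 2 + 3 / 4 * δ⁻¹ * b ^ 2 := by
    field_simp
    ring
  have : 0 ≤ δ * (a - δ⁻¹ * b / 2) ^ 2 + 3 / 4 * δ⁻¹ * b ^ 2 := by positivity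
  linarith

/-! ### Contractions towards the edges -/

/-- The weight in the variable `i` attached to `e ∈ {-1, 0, 1}`: it is `1 + e x` for `e = ±1`,
vanishing at the end `x = -e` only, and `1 - x²` for `e = 0`, vanishing at both ends. -/
noncomputable def weight (i : Fin 2) (e : ℝ) : MvPolynomial (Fin 2) ℝ :=
  1 + C e * X i - C (1 - e ^ 2) * X i ^ 2

/-- Substitution of the contraction `x ↦ (3 e + x) / 4` into the variable `i`. For `e = ±1` it
maps `[-1, 1]` into itself with fixed point `e`. -/
noncomputable def contract (i : Fin 2) (e : ℝ) :
    MvPolynomial (Fin 2) ℝ →ₐ[ℝ] MvPolynomial (Fin 2) ℝ :=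
  bind₁ (Function.update X i (C (3 * e / 4) + C (1 / 4) * X i))

/-- The difference `P(x) - e² k P((3 e + x) / 4)` in the variable `i`. For `e = ±1` and `k = 1`
it vanishes at `x = e`, and for `e = 0` it is `P` itself. -/
noncomputable def contractDiff (i : Fin 2) (e k : ℝ) (P : MvPolynomial (Fin 2) ℝ) :
    MvPolynomial (Fin 2) ℝ :=
  P - C (e ^ 2 * k) * contract i e P

lemma eval_weight (i : Fin 2) (e x t : ℝ) :
    eval (slice i x t) (weight i e) = 1 + e * x - (1 - e ^ 2) * x ^ 2 := by
  simp [weight, slice]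

lemma eval_contract (i : Fin 2) (e : ℝ) (P : MvPolynomial (Fin 2) ℝ) (v : Fin 2 → ℝ) :
    eval v (contract i e P) = eval (Function.update v i ((3 * e + v i) / 4)) P := by
  have h := eval₂Hom_bind₁ (RingHom.id ℝ) v
    (Function.update X i (C (3 * e / 4) + C (1 / 4) * X i)) P
  refine h.trans ?_
  change eval _ P = _
  congr 2
  funext j
  change eval v _ = _
  by_cases hj : j = i
  · subst hj; simp; ring
  · simp [hj]

lemma eval_contractDiff (i : Fin 2) (e k x t : ℝ) (P : MvPolynomial (Fin 2) ℝ) :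
    eval (slice i x t) (contractDiff i e k P)
      = eval (slice i x t) P - e ^ 2 * k * eval (slice i ((3 * e + x) / 4) t) P := by
  have : slice i x t i = x := by simp [slice]
  simp only [contractDiff, map_sub, map_mul, eval_C, eval_contract, update_slice, this]

lemma pderiv_contract (i j : Fin 2) (e : ℝ) (P : MvPolynomial (Fin 2) ℝ) :
    pderiv j (contract i e P)
      = C (if j = i then 1 / 4 else 1) * contract i e (pderiv j P) := by
  induction P using MvPolynomial.induction_on with
  | C a => simp [contract]
  | add p q hp hq => simp only [map_add, hp, hq, mul_add]
  | mul_X p k hp =>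
    have hX : pderiv j (contract i e (X k))
        = C (if j = i then 1 / 4 else 1) * contract i e (pderiv j (X k)) := by
      by_cases hk : k = i
      · subst hk
        by_cases hj : j = k
        · subst hj; simp [contract]
        · simp [contract, pderiv_X_of_ne (Ne.symm hj), hj]
      · by_cases hj : k = j
        · subst hj; simp [contract, hk]
        · simp [contract, hk, pderiv_X_of_ne hj]
    rw [map_mul, pderiv_mul, pderiv_mul, hX, hp, map_add, map_mul, map_mul]
    ring

lemma pderiv_contractDiff_self (i : Fin 2) (e k : ℝ) (P : MvPolynomial (Fin 2) ℝ) :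
    pderiv i (contractDiff i e k P) = contractDiff i e (k / 4) (pderiv i P) := by
  simp only [contractDiff, map_sub, pderiv_C_mul, pderiv_contract, if_true]
  rw [← mul_assoc, ← C_mul]
  congr 3
  ring

lemma pderiv_contractDiff_of_ne {i j : Fin 2} (h : j ≠ i) (e k : ℝ)
    (P : MvPolynomial (Fin 2) ℝ) :
    pderiv j (contractDiff i e k P) = contractDiff i e k (pderiv j P) := by
  simp [contractDiff, pderiv_contract, h]

lemma contract_comm {i j : Fin 2} (h : j ≠ i) (e e' : ℝ) (P : MvPolynomial (Fin 2) ℝ) :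
    contract i e (contract j e' P) = contract j e' (contract i e P) := by
  refine MvPolynomial.funext fun v => ?_
  simp only [eval_contract, Function.update_of_ne h, Function.update_of_ne h.symm,
    Function.update_comm h]

lemma contractDiff_comm {i j : Fin 2} (h : j ≠ i) (e e' k k' : ℝ)
    (P : MvPolynomial (Fin 2) ℝ) :
    contractDiff i e k (contractDiff j e' k' P)
      = contractDiff j e' k' (contractDiff i e k P) := by
  have hC (i : Fin 2) (e a : ℝ) : contract i e (C a) = C a := by simp [contract]
  simp only [contractDiff, map_sub, map_mul, hC, contract_comm h]
  ring

/-! ### One-dimensional estimates -/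

lemma integral_sq_add_le {f g : ℝ → ℝ} (hf : Continuous f) (hg : Continuous g) {a b : ℝ}
    (hab : a ≤ b) : ∫ x in a..b, f x ^ 2
      ≤ 2 * (∫ x in a..b, (f x - g x) ^ 2) + 2 * ∫ x in a..b, g x ^ 2 := by
  rw [← intervalIntegral.integral_const_mul, ← intervalIntegral.integral_const_mul,
    ← intervalIntegral.integral_add ((by fun_prop : Continuous _).intervalIntegrable _ _)
      ((by fun_prop : Continuous _).intervalIntegrable _ _)]
  refine intervalIntegral.integral_mono_on hab
    ((by fun_prop : Continuous _).intervalIntegrable _ _)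
    ((by fun_prop : Continuous _).intervalIntegrable _ _) fun x _ => ?_
  nlinarith [sq_nonneg (f x - 2 * g x)]

lemma integral_mono_interval_of_nonneg {f : ℝ → ℝ} (hf : Continuous f) {a b c d : ℝ}
    (hca : c ≤ a) (hab : a ≤ b) (hbd : b ≤ d) (h0 : ∀ x ∈ Set.Icc c d, 0 ≤ f x) :
    ∫ x in a..b, f x ≤ ∫ x in c..d, f x := by
  refine intervalIntegral.integral_mono_interval hca hab hbd ?_ (hf.intervalIntegrable _ _)
  exact (ae_restrict_iff' measurableSet_Ioc).2
    (Filter.Eventually.of_forall fun x hx => h0 x (Set.Ioc_subset_Icc_self hx))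

/-- Near the end `1` a function is controlled by its difference with its contraction: the
contraction by the factor `4` doubles the `L²` norm, so it cannot be balanced by `h` itself. -/
lemma integral_sq_near_one_le {h : ℝ → ℝ} (hh : Continuous h) :
    ∫ x in (3 / 4 : ℝ)..1, h x ^ 2
      ≤ (∫ x in (-1 : ℝ)..1, (1 + x) * (h x - h ((3 + x) / 4)) ^ 2)
        + ∫ x in (0 : ℝ)..(3 / 4), h x ^ 2 := by
  have hscale : ∫ x in (0 : ℝ)..1, h ((3 + x) / 4) ^ 2 = 4 * ∫ x in (3 / 4 : ℝ)..1, h x ^ 2 := by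
    have := intervalIntegral.integral_comp_add_mul (a := 0) (b := 1) (fun x => h x ^ 2)
      (by norm_num : (1 / 4 : ℝ) ≠ 0) (3 / 4)
    norm_num at this
    rw [← this]
    congr 1
    funext x
    congr 2
    ring
  have h1 := integral_sq_add_le (f := fun x => h ((3 + x) / 4)) (g := h) (by fun_prop) hh
    (zero_le_one)
  have h2 : ∫ x in (0 : ℝ)..1, (h ((3 + x) / 4) - h x) ^ 2
      ≤ ∫ x in (0 : ℝ)..1, (1 + x) * (h x - h ((3 + x) / 4)) ^ 2 := by
    refine intervalIntegral.integral_mono_on zero_le_one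
      ((by fun_prop : Continuous _).intervalIntegrable _ _)
      ((by fun_prop : Continuous _).intervalIntegrable _ _) fun x hx => ?_
    nlinarith [sq_nonneg (h x - h ((3 + x) / 4)), hx.1,
      mul_nonneg hx.1 (sq_nonneg (h x - h ((3 + x) / 4)))]
  have h3 : ∫ x in (0 : ℝ)..1, (1 + x) * (h x - h ((3 + x) / 4)) ^ 2
      ≤ ∫ x in (-1 : ℝ)..1, (1 + x) * (h x - h ((3 + x) / 4)) ^ 2 :=
    integral_mono_interval_of_nonneg (by fun_prop) (by norm_num) zero_le_one le_rfl
      fun x hx => mul_nonneg (by linarith [hx.1]) (sq_nonneg _)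
  have h4 : (∫ x in (0 : ℝ)..(3 / 4), h x ^ 2) + ∫ x in (3 / 4 : ℝ)..1, h x ^ 2
      = ∫ x in (0 : ℝ)..1, h x ^ 2 :=
    intervalIntegral.integral_add_adjacent_intervals
      ((by fun_prop : Continuous _).intervalIntegrable _ _)
      ((by fun_prop : Continuous _).intervalIntegrable _ _)
  linarith

/-- The three weighted forms together control the `L²` norm on `[-1, 1]`: the form `e = 0` in
the interior, and the forms `e = ±1` near the ends. -/
lemma integral_sq_le_weighted {h : ℝ → ℝ} (hh : Continuous h) {A : ℝ → ℝ}
    (hA : ∀ e, A e = ∫ x in (-1 : ℝ)..1,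
      (1 + e * x - (1 - e ^ 2) * x ^ 2) * (h x - e ^ 2 * 1 * h ((3 * e + x) / 4)) ^ 2) :
    ∫ x in (-1 : ℝ)..1, h x ^ 2 ≤ 5 * (A (-1) + A 0 + A 1) := by
  have hc : Continuous fun x => h x ^ 2 := by fun_prop
  have hi (a b : ℝ) : IntervalIntegrable (fun x => h x ^ 2) volume a b := hc.intervalIntegrable _ _
  have hp : ∫ x in (3 / 4 : ℝ)..1, h x ^ 2 ≤ A 1 + ∫ x in (0 : ℝ)..(3 / 4), h x ^ 2 := by
    have := integral_sq_near_one_le hh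
    rw [hA]
    norm_num
    exact this
  have hm : ∫ x in (-1 : ℝ)..(-(3 / 4)), h x ^ 2
      ≤ A (-1) + ∫ x in (-(3 / 4) : ℝ)..0, h x ^ 2 := by
    have := integral_sq_near_one_le (h := fun x => h (-x)) (by fun_prop)
    have e1 := intervalIntegral.integral_comp_neg (a := 3 / 4) (b := 1) (fun x => h x ^ 2)
    have e2 := intervalIntegral.integral_comp_neg (a := 0) (b := 3 / 4) (fun x => h x ^ 2)
    have e3 := intervalIntegral.integral_comp_neg (a := -1) (b := 1)
      (fun x => (1 - x) * (h x - h ((-3 + x) / 4)) ^ 2)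
    rw [neg_zero] at e2
    rw [neg_neg] at e3
    rw [e1, e2] at this
    refine this.trans (add_le_add_left (le_of_eq ?_) _)
    rw [hA, ← (show _ = ∫ x in (-1 : ℝ)..1, (1 + -1 * x - (1 - (-1) ^ 2) * x ^ 2)
      * (h x - (-1) ^ 2 * 1 * h ((3 * -1 + x) / 4)) ^ 2 from by
        refine e3.trans ?_
        congr 1
        funext x
        ring_nf)]
    congr 1
    funext x
    ring_nf
  have h0 : ∫ x in (-(3 / 4) : ℝ)..(3 / 4), h x ^ 2 ≤ 16 / 7 * A 0 := by
    rw [hA]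
    have e1 : ∫ x in (-(3 / 4) : ℝ)..(3 / 4), h x ^ 2
        ≤ ∫ x in (-(3 / 4) : ℝ)..(3 / 4), 16 / 7 * ((1 - x ^ 2) * h x ^ 2) := by
      refine intervalIntegral.integral_mono_on (by norm_num) (hi _ _)
        ((by fun_prop : Continuous _).intervalIntegrable _ _) fun x hx => ?_
      have : 0 ≤ (3 / 4 - x) * (3 / 4 + x) := mul_nonneg (by linarith [hx.2]) (by linarith [hx.1])
      nlinarith [mul_nonneg this (sq_nonneg (h x))]
    have e2 : ∫ x in (-(3 / 4) : ℝ)..(3 / 4), (1 - x ^ 2) * h x ^ 2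
        ≤ ∫ x in (-1 : ℝ)..1, (1 - x ^ 2) * h x ^ 2 :=
      integral_mono_interval_of_nonneg (by fun_prop) (by norm_num) (by norm_num) (by norm_num)
        fun x hx => mul_nonneg (by nlinarith [hx.1, hx.2]) (sq_nonneg _)
    rw [intervalIntegral.integral_const_mul] at e1
    norm_num at e1 e2 ⊢
    linarith
  have hA0 : 0 ≤ A (-1) ∧ 0 ≤ A 1 := by
    constructor <;> rw [hA] <;>
      exact intervalIntegral.integral_nonneg (by norm_num) fun x hx =>
        mul_nonneg (by nlinarith [hx.1, hx.2]) (sq_nonneg _)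
  have s1 := intervalIntegral.integral_add_adjacent_intervals (hi (-1) (-(3 / 4))) (hi _ (3 / 4))
  have s2 := intervalIntegral.integral_add_adjacent_intervals (hi (-1) (3 / 4)) (hi _ 1)
  have s3 := intervalIntegral.integral_add_adjacent_intervals (hi (-(3 / 4)) 0) (hi _ (3 / 4))
  have hA00 : 0 ≤ A 0 := by
    have : 0 ≤ ∫ x in (-(3 / 4) : ℝ)..(3 / 4), h x ^ 2 :=
      intervalIntegral.integral_nonneg (by norm_num) fun x _ => sq_nonneg _
    linarith
  linarith [hA0.1, hA0.2]

/-- Differences with contractions are bounded in `L²`. -/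
lemma integral_contractDiff_sq_le {h : ℝ → ℝ} (hh : Continuous h) {e : ℝ}
    (he : e = -1 ∨ e = 0 ∨ e = 1) (k : ℝ) :
    ∫ x in (-1 : ℝ)..1, (h x - e ^ 2 * k * h ((3 * e + x) / 4)) ^ 2
      ≤ (2 + 8 * k ^ 2) * ∫ x in (-1 : ℝ)..1, h x ^ 2 := by
  have hc : Continuous fun x => h x ^ 2 := by fun_prop
  have h0 : 0 ≤ ∫ x in (-1 : ℝ)..1, h x ^ 2 :=
    intervalIntegral.integral_nonneg (by norm_num) fun x _ => sq_nonneg _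
  have h1 : e ^ 2 * ∫ x in (-1 : ℝ)..1, h ((3 * e + x) / 4) ^ 2
      ≤ 4 * ∫ x in (-1 : ℝ)..1, h x ^ 2 := by
    have := intervalIntegral.integral_comp_add_mul (a := -1) (b := 1) (fun x => h x ^ 2)
      (by norm_num : (1 / 4 : ℝ) ≠ 0) (3 / 4 * e)
    have h2 : ∫ x in (-1 : ℝ)..1, h ((3 * e + x) / 4) ^ 2
        = 4 * ∫ x in (3 / 4 * e + 1 / 4 * -1)..(3 / 4 * e + 1 / 4 * 1), h x ^ 2 := by
      have h4 : ((1 / 4 : ℝ))⁻¹ = 4 := by norm_num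
      rw [h4, smul_eq_mul] at this
      rw [← this]
      congr 1
      funext x
      ring_nf
    rcases he with rfl | rfl | rfl
    · rw [h2]
      have := integral_mono_interval_of_nonneg hc (a := 3 / 4 * -1 + 1 / 4 * -1)
        (b := 3 / 4 * -1 + 1 / 4 * 1) (c := -1) (d := 1) (by norm_num) (by norm_num)
        (by norm_num) fun x _ => sq_nonneg _
      linarith
    · linarith
    · rw [h2]
      have := integral_mono_interval_of_nonneg hc (a := 3 / 4 * 1 + 1 / 4 * -1)
        (b := 3 / 4 * 1 + 1 / 4 * 1) (c := -1) (d := 1) (by norm_num) (by norm_num)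
        (by norm_num) fun x _ => sq_nonneg _
      linarith
  have h3 := integral_sq_add_le (f := fun x => h x - e ^ 2 * k * h ((3 * e + x) / 4))
    (g := fun x => - (e ^ 2 * k * h ((3 * e + x) / 4))) (by fun_prop) (by fun_prop)
    (by norm_num : (-1 : ℝ) ≤ 1)
  have h4 : ∫ x in (-1 : ℝ)..1, (-(e ^ 2 * k * h ((3 * e + x) / 4))) ^ 2
      = k ^ 2 * (e ^ 2 * ∫ x in (-1 : ℝ)..1, h ((3 * e + x) / 4) ^ 2) := by
    rw [← intervalIntegral.integral_const_mul, ← intervalIntegral.integral_const_mul]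
    congr 1
    funext x
    have : e ^ 4 = e ^ 2 := by rcases he with rfl | rfl | rfl <;> norm_num
    linear_combination k ^ 2 * h ((3 * e + x) / 4) ^ 2 * this
  rw [h4] at h3
  simp only [sub_neg_eq_add, sub_add_cancel] at h3
  nlinarith [mul_le_mul_of_nonneg_left h1 (sq_nonneg k)]

/-! ### Estimates on the square -/

/-- Integrated form of `integral_sq_le_weighted` in the variable `i`, with an additional
nonnegative weight `ω` depending only on the other variable. -/
lemma sqInt_mul_sq_le (i : Fin 2) {ω : MvPolynomial (Fin 2) ℝ} {c : ℝ → ℝ}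
    (hω : ∀ x t, eval (slice i x t) ω = c t) (hc : ∀ t ∈ Set.Icc (-1 : ℝ) 1, 0 ≤ c t)
    (P : MvPolynomial (Fin 2) ℝ) {B : ℝ → ℝ}
    (hB : ∀ e, B e = sqInt (ω * (weight i e * contractDiff i e 1 P ^ 2))) :
    sqInt (ω * P ^ 2) ≤ 5 * (B (-1) + B 0 + B 1) := by
  simp only [hB]
  rw [← sqInt_add, ← sqInt_add, ← sqInt_C_mul]
  refine sqInt_le_of_slice i fun t ht => ?_
  have h1 := integral_sq_le_weighted (continuous_eval_slice_left i P t) (A := _) fun _ => rfl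
  have hint (e : ℝ) : IntervalIntegrable (fun x => (1 + e * x - (1 - e ^ 2) * x ^ 2) *
      (eval (slice i x t) P - e ^ 2 * 1 * eval (slice i ((3 * e + x) / 4) t) P) ^ 2)
      volume (-1) 1 := by
    have := continuous_eval_slice_left i P t
    have h' : Continuous fun x : ℝ => eval (slice i ((3 * e + x) / 4) t) P :=
      this.comp (by fun_prop : Continuous fun x : ℝ => (3 * e + x) / 4)
    exact (by fun_prop : Continuous _).intervalIntegrable _ _
  beta_reduce at h1
  rw [← intervalIntegral.integral_add (hint _) (hint _),
    ← intervalIntegral.integral_add ((hint _).add (hint _)) (hint _)] at h1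
  have h2 := mul_le_mul_of_nonneg_left h1 (hc t ht)
  rw [← intervalIntegral.integral_const_mul, ← intervalIntegral.integral_const_mul,
    ← intervalIntegral.integral_const_mul] at h2
  simp only [map_mul, map_add, map_pow, eval_C, hω, eval_weight, eval_contractDiff]
  refine h2.trans (le_of_eq ?_)
  congr 1
  funext x
  ring

lemma sqNorm_contractDiff_le (i : Fin 2) {e : ℝ} (he : e = -1 ∨ e = 0 ∨ e = 1) (k : ℝ)
    (P : MvPolynomial (Fin 2) ℝ) :
    sqNorm (contractDiff i e k P) ≤ (2 + 8 * k ^ 2) * sqNorm P := by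
  unfold sqNorm
  rw [← sqInt_C_mul]
  refine sqInt_le_of_slice i fun t _ => ?_
  simp only [map_mul, map_pow, eval_C, eval_contractDiff]
  rw [intervalIntegral.integral_const_mul]
  exact integral_contractDiff_sq_le (continuous_eval_slice_left i P t) he k

/-- The second-order operator `P ↦ ∂(w ∂(P - 4 e² P ∘ contraction))` in the variable `i`, the
divergence of a flux which vanishes on the edges `x_i = ±1`. -/
noncomputable def edgeOp (i : Fin 2) (e : ℝ) (P : MvPolynomial (Fin 2) ℝ) :
    MvPolynomial (Fin 2) ℝ :=
  pderiv i (weight i e * pderiv i (contractDiff i e 4 P))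

/-- On an edge either the weight vanishes or, at the fixed point of the contraction, the
derivative of the difference does. -/
lemma eval_flux_eq_zero (i : Fin 2) {e : ℝ} (he : e = -1 ∨ e = 0 ∨ e = 1)
    (P : MvPolynomial (Fin 2) ℝ) {x : ℝ} (hx : x = 1 ∨ x = -1) (t : ℝ) :
    eval (slice i x t) (weight i e * pderiv i (contractDiff i e 4 P)) = 0 := by
  rw [pderiv_contractDiff_self, map_mul, eval_weight, eval_contractDiff]
  rcases he with rfl | rfl | rfl <;> rcases hx with rfl | rfl <;> norm_num

lemma sqNorm_edgeOp_le (i : Fin 2) {e : ℝ} (he : e = -1 ∨ e = 0 ∨ e = 1)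
    (P : MvPolynomial (Fin 2) ℝ) :
    sqNorm (edgeOp i e P) ≤ 80 * (sqNorm (pderiv i P) + sqNorm (pderiv i (pderiv i P))) := by
  have h1 := sqNorm_contractDiff_le i he 1 (pderiv i P)
  have h2 := sqNorm_contractDiff_le i he (1 / 4) (pderiv i (pderiv i P))
  have h3 : sqNorm (edgeOp i e P) ≤ 8 * sqNorm (contractDiff i e 1 (pderiv i P))
      + 8 * sqNorm (contractDiff i e (1 / 4) (pderiv i (pderiv i P))) := by
    unfold sqNorm
    rw [← sqInt_C_mul, ← sqInt_C_mul, ← sqInt_add]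
    refine sqInt_mono i fun x hx t _ => ?_
    have hk : (4 : ℝ) / 4 = 1 := by norm_num
    rw [edgeOp, pderiv_mul, pderiv_contractDiff_self, pderiv_contractDiff_self, hk]
    simp only [map_mul, map_add, map_pow, eval_C, eval_weight]
    have hw : eval (slice i x t) (pderiv i (weight i e)) = e - 2 * (1 - e ^ 2) * x := by
      simp only [weight, map_sub, map_add, pderiv_C_mul, pderiv_X_self, pderiv_one]
      simp [slice]
      ring
    rw [hw]
    set a := eval (slice i x t) (contractDiff i e 1 (pderiv i P))
    set b := eval (slice i x t) (contractDiff i e (1 / 4) (pderiv i (pderiv i P)))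
    have hw1 : (e - 2 * (1 - e ^ 2) * x) ^ 2 ≤ 4 := by
      rcases he with rfl | rfl | rfl <;> nlinarith [hx.1, hx.2]
    have hw2 : (1 + e * x - (1 - e ^ 2) * x ^ 2) ^ 2 ≤ 4 := by
      have : x ^ 2 ≤ 1 := by nlinarith [hx.1, hx.2]
      rcases he with rfl | rfl | rfl <;> nlinarith [hx.1, hx.2]
    nlinarith [mul_le_mul_of_nonneg_right hw1 (sq_nonneg a),
      mul_le_mul_of_nonneg_right hw2 (sq_nonneg b),
      sq_nonneg ((e - 2 * (1 - e ^ 2) * x) * a - (1 + e * x - (1 - e ^ 2) * x ^ 2) * b)]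
  have h4 := sqNorm_nonneg (pderiv i P)
  have h5 := sqNorm_nonneg (pderiv i (pderiv i P))
  linarith

lemma sqNorm_neg (P : MvPolynomial (Fin 2) ℝ) : sqNorm (-P) = sqNorm P := by
  simp [sqNorm]

/-- Interpolation: a first derivative is controlled by the function and the pure second
derivative. -/
lemma sqNorm_pderiv_le (i : Fin 2) (P : MvPolynomial (Fin 2) ℝ) :
    sqNorm (pderiv i P) ≤ 10000000 * sqNorm P + sqNorm (pderiv i (pderiv i P)) := by
  have key (e : ℝ) (he : e = -1 ∨ e = 0 ∨ e = 1) :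
      sqInt (1 * (weight i e * contractDiff i e 1 (pderiv i P) ^ 2))
        ≤ 1 / 30 * (sqNorm (pderiv i P) + sqNorm (pderiv i (pderiv i P)))
          + 312000 * sqNorm P := by
    have hk : (4 : ℝ) / 4 = 1 := by norm_num
    have h1 : sqInt (1 * (weight i e * contractDiff i e 1 (pderiv i P) ^ 2))
        = sqInt (-edgeOp i e P * contractDiff i e 4 P) := by
      have := sqInt_pderiv_mul i (contractDiff i e 4 P)
        (eval_flux_eq_zero i he P (Or.inl rfl)) (eval_flux_eq_zero i he P (Or.inr rfl))
      rw [pderiv_contractDiff_self, hk] at this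
      rw [one_mul, sq, ← mul_assoc, this, edgeOp, pderiv_contractDiff_self, hk]
      have h (Q : MvPolynomial (Fin 2) ℝ) : -sqInt Q = sqInt (-Q) := by
        rw [neg_eq_neg_one_mul, ← sqInt_C_mul]; simp
      rw [h, neg_mul]
    have h2 := sqInt_mul_le (-edgeOp i e P) (contractDiff i e 4 P)
      (by norm_num : (0 : ℝ) < 1 / 2400)
    have h3 := sqNorm_edgeOp_le i he P
    have h4 := sqNorm_contractDiff_le i he 4 P
    rw [sqNorm_neg] at h2
    rw [h1]
    norm_num at h2 h4 ⊢
    linarith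
  have h := sqInt_mul_sq_le i (ω := 1) (c := fun _ => 1) (by simp) (by simp) (pderiv i P)
    (B := _) fun _ => rfl
  have k1 := key (-1) (by simp)
  have k2 := key 0 (by simp)
  have k3 := key 1 (by simp)
  have hN : sqInt (1 * pderiv i P ^ 2) = sqNorm (pderiv i P) := by rw [one_mul, sqNorm]
  have h0 := sqNorm_nonneg P
  rw [hN] at h
  linarith

lemma sqNorm_edgeOp_le' (i : Fin 2) {e : ℝ} (he : e = -1 ∨ e = 0 ∨ e = 1)
    (P : MvPolynomial (Fin 2) ℝ) :
    sqNorm (edgeOp i e P) ≤ 800000000 * (sqNorm P + sqNorm (pderiv i (pderiv i P))) := by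
  have h1 := sqNorm_edgeOp_le i he P
  have h2 := sqNorm_pderiv_le i P
  have h3 := sqNorm_nonneg (pderiv i (pderiv i P))
  linarith

/-- Two integrations by parts turn the weighted norm of a mixed derivative into a pairing of
pure second-order expressions. All boundary terms vanish because the fluxes do. -/
lemma sqInt_weight_mul_mixed_sq {a b : ℝ} (ha : a = -1 ∨ a = 0 ∨ a = 1)
    (hb : b = -1 ∨ b = 0 ∨ b = 1) (P : MvPolynomial (Fin 2) ℝ) :
    sqInt (weight 0 a * (weight 1 b *
        contractDiff 1 b 1 (contractDiff 0 a 1 (pderiv 0 (pderiv 1 P))) ^ 2))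
      = sqInt (contractDiff 1 b 4 (edgeOp 0 a P) * contractDiff 0 a 4 (edgeOp 1 b P)) := by
  have hk : (4 : ℝ) / 4 = 1 := by norm_num
  have h01 : (1 : Fin 2) ≠ 0 := by decide
  have hw0 : pderiv 1 (weight 0 a) = 0 := by
    simp [weight, pderiv_X_of_ne h01.symm]
  have hw1 : pderiv 0 (weight 1 b) = 0 := by
    simp [weight, pderiv_X_of_ne h01]
  set U := contractDiff 1 b 4 (contractDiff 0 a 4 P) with hU
  have hU' : U = contractDiff 0 a 4 (contractDiff 1 b 4 P) := contractDiff_comm h01.symm ..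
  have hmix : contractDiff 1 b 1 (contractDiff 0 a 1 (pderiv 0 (pderiv 1 P)))
      = pderiv 0 (pderiv 1 U) := by
    rw [hU, pderiv_contractDiff_self, hk, pderiv_contractDiff_of_ne h01,
      pderiv_contractDiff_of_ne h01.symm, pderiv_contractDiff_self, hk]
  have hcw0 (Q : MvPolynomial (Fin 2) ℝ) :
      contractDiff 1 b 4 (weight 0 a * Q) = weight 0 a * contractDiff 1 b 4 Q := by
    have : contract 1 b (weight 0 a) = weight 0 a := by simp [contract, weight]
    simp only [contractDiff, map_mul, this]
    ring
  have hcw1 (Q : MvPolynomial (Fin 2) ℝ) :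
      contractDiff 0 a 4 (weight 1 b * Q) = weight 1 b * contractDiff 0 a 4 Q := by
    have : contract 0 a (weight 1 b) = weight 1 b := by simp [contract, weight]
    simp only [contractDiff, map_mul, this]
    ring
  have hA : contractDiff 1 b 4 (edgeOp 0 a P) = pderiv 0 (weight 0 a * pderiv 0 U) := by
    rw [edgeOp, ← pderiv_contractDiff_of_ne h01.symm, hcw0, ← pderiv_contractDiff_of_ne h01.symm]
  have hB : contractDiff 0 a 4 (edgeOp 1 b P) = pderiv 1 (weight 1 b * pderiv 1 U) := by
    rw [edgeOp, ← pderiv_contractDiff_of_ne h01, hcw1, ← pderiv_contractDiff_of_ne h01, hU']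
  -- The flux of `∂₁ U` across the edges `x₀ = ±1` vanishes.
  have hF (x : ℝ) (hx : x = 1 ∨ x = -1) (t : ℝ) :
      eval (slice 0 x t) (weight 0 a * pderiv 0 (pderiv 1 U) * weight 1 b) = 0 := by
    have := eval_flux_eq_zero 0 ha (pderiv 1 (contractDiff 1 b 4 P)) hx t
    rw [hU', pderiv_contractDiff_of_ne h01, map_mul, this, zero_mul]
  have hG (x : ℝ) (hx : x = 1 ∨ x = -1) (t : ℝ) :
      eval (slice 1 x t) (weight 1 b * pderiv 1 U) = 0 :=
    eval_flux_eq_zero 1 hb (contractDiff 0 a 4 P) hx t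
  have i1 := sqInt_pderiv_mul 0 (pderiv 1 U) (hF 1 (Or.inl rfl)) (hF (-1) (Or.inr rfl))
  have i2 := sqInt_pderiv_mul 1 (pderiv 0 (weight 0 a * pderiv 0 U))
    (hG 1 (Or.inl rfl)) (hG (-1) (Or.inr rfl))
  have hcomm : pderiv 1 (pderiv 0 (weight 0 a * pderiv 0 U))
      = pderiv 0 (weight 0 a * pderiv 0 (pderiv 1 U)) := by
    rw [pderiv_comm, pderiv_mul (i := 1), hw0, zero_mul, zero_add, pderiv_comm 1 0 U]
  rw [hmix, hA, hB]
  have e1 : weight 0 a * (weight 1 b * pderiv 0 (pderiv 1 U) ^ 2)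
      = weight 0 a * pderiv 0 (pderiv 1 U) * weight 1 b * pderiv 0 (pderiv 1 U) := by ring
  have e2 : pderiv 0 (weight 0 a * pderiv 0 (pderiv 1 U) * weight 1 b) * pderiv 1 U
      = weight 1 b * pderiv 1 U * pderiv 1 (pderiv 0 (weight 0 a * pderiv 0 U)) := by
    rw [pderiv_mul, hw1, mul_zero, add_zero, hcomm]
    ring
  rw [e1, i1, e2, i2, neg_neg, mul_comm]

/-- The mixed second derivative is controlled by the pure ones, with one of the two as small a
factor as desired. -/
lemma exists_sqNorm_mixed_le : ∃ K : ℝ, 0 < K ∧ ∀ (P : MvPolynomial (Fin 2) ℝ) (δ : ℝ), 0 < δ →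
    sqNorm (pderiv 0 (pderiv 1 P)) ≤ K * (δ * (sqNorm P + sqNorm (pderiv 0 (pderiv 0 P)))
      + δ⁻¹ * (sqNorm P + sqNorm (pderiv 1 (pderiv 1 P)))) := by
  refine ⟨225 * (130 * 800000000), by norm_num, fun P δ hδ => ?_⟩
  have hδ' : 0 < δ⁻¹ := inv_pos.2 hδ
  set R := δ * (sqNorm P + sqNorm (pderiv 0 (pderiv 0 P)))
      + δ⁻¹ * (sqNorm P + sqNorm (pderiv 1 (pderiv 1 P))) with hR
  have key (a b : ℝ) (ha : a = -1 ∨ a = 0 ∨ a = 1) (hb : b = -1 ∨ b = 0 ∨ b = 1) :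
      sqInt (weight 0 a * (weight 1 b *
        contractDiff 1 b 1 (contractDiff 0 a 1 (pderiv 0 (pderiv 1 P))) ^ 2))
      ≤ 130 * 800000000 * R := by
    rw [sqInt_weight_mul_mixed_sq ha hb]
    refine (sqInt_mul_le _ _ hδ).trans ?_
    have h1 := sqNorm_contractDiff_le 1 hb 4 (edgeOp 0 a P)
    have h2 := sqNorm_contractDiff_le 0 ha 4 (edgeOp 1 b P)
    have h3 := sqNorm_edgeOp_le' 0 ha P
    have h4 := sqNorm_edgeOp_le' 1 hb P
    norm_num at h1 h2
    have h5 := mul_le_mul_of_nonneg_left (h1.trans (mul_le_mul_of_nonneg_left h3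
      (by norm_num))) hδ.le
    have h6 := mul_le_mul_of_nonneg_left (h2.trans (mul_le_mul_of_nonneg_left h4
      (by norm_num))) hδ'.le
    rw [hR]
    linarith
  have key' (a : ℝ) (ha : a = -1 ∨ a = 0 ∨ a = 1) :
      sqInt (1 * (weight 0 a * contractDiff 0 a 1 (pderiv 0 (pderiv 1 P)) ^ 2))
      ≤ 15 * (130 * 800000000 * R) := by
    rw [one_mul]
    have h := sqInt_mul_sq_le 1 (ω := weight 0 a) (c := fun t => 1 + a * t - (1 - a ^ 2) * t ^ 2)
      (fun x t => by rw [slice_swap (by decide : (0 : Fin 2) ≠ 1), eval_weight])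
      (fun t ht => by rcases ha with rfl | rfl | rfl <;> nlinarith [ht.1, ht.2])
      (contractDiff 0 a 1 (pderiv 0 (pderiv 1 P))) (B := _) fun _ => rfl
    have k1 := key a (-1) ha (by simp)
    have k2 := key a 0 ha (by simp)
    have k3 := key a 1 ha (by simp)
    linarith
  have h := sqInt_mul_sq_le 0 (ω := 1) (c := fun _ => 1) (by simp) (by simp)
    (pderiv 0 (pderiv 1 P)) (B := _) fun _ => rfl
  have k1 := key' (-1) (by simp)
  have k2 := key' 0 (by simp)
  have k3 := key' 1 (by simp)
  have hN : sqInt (1 * pderiv 0 (pderiv 1 P) ^ 2) = sqNorm (pderiv 0 (pderiv 1 P)) := by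
    rw [one_mul, sqNorm]
  rw [hN] at h
  linarith

/-! ### The two forms -/

/-- The formal partial derivative `∂_ξ^i ∂_η^j` of a polynomial. -/
noncomputable def mixedDeriv (i j : ℕ) (u : MvPolynomial (Fin 2) ℝ) : MvPolynomial (Fin 2) ℝ :=
  (pderiv 0)^[i] ((pderiv 1)^[j] u)

lemma mixedDeriv_succ_left (i j : ℕ) (u : MvPolynomial (Fin 2) ℝ) :
    mixedDeriv (i + 1) j u = pderiv 0 (mixedDeriv i j u) :=
  Function.iterate_succ_apply' ..

lemma mixedDeriv_succ_right (i j : ℕ) (u : MvPolynomial (Fin 2) ℝ) :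
    mixedDeriv i (j + 1) u = pderiv 1 (mixedDeriv i j u) := by
  induction i with
  | zero => exact Function.iterate_succ_apply' ..
  | succ i ih => rw [mixedDeriv_succ_left, ih, pderiv_comm, ← mixedDeriv_succ_left]

lemma iteratedDeriv_eval_slice (i : Fin 2) (n : ℕ) (P : MvPolynomial (Fin 2) ℝ) (t : ℝ) :
    iteratedDeriv n (fun x => eval (slice i x t) P)
      = fun x => eval (slice i x t) ((pderiv i)^[n] P) := by
  induction n with
  | zero => simp
  | succ n ih =>
    rw [iteratedDeriv_succ, ih, Function.iterate_succ_apply']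
    exact _root_.funext fun x => (hasDerivAt_eval_slice i _ x t).deriv

lemma partialDeriv_toFun (i j : ℕ) (u : MvPolynomial (Fin 2) ℝ) :
    partialDeriv i j (toFun u) = toFun (mixedDeriv i j u) := by
  funext p
  have h1 (x : ℝ) : iteratedDeriv j (fun y => toFun u (x, y)) p.2
      = eval (slice 0 x p.2) ((pderiv 1)^[j] u) := by
    have := congrFun (iteratedDeriv_eval_slice 1 j u x) p.2
    simp only [slice_one] at this
    rw [slice_zero]
    exact this
  have := congrFun (iteratedDeriv_eval_slice 0 i ((pderiv 1)^[j] u) p.2) p.1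
  rw [slice_zero] at this
  simp only [partialDeriv, h1]
  exact this

lemma formC_toFun (u : MvPolynomial (Fin 2) ℝ) :
    formC (toFun u) = sqNorm (mixedDeriv 4 0 u) + sqNorm (mixedDeriv 0 4 u)
      + sqNorm (mixedDeriv 3 0 u) + sqNorm (mixedDeriv 0 3 u)
      + sqNorm (mixedDeriv 2 0 u) + sqNorm (mixedDeriv 0 2 u)
      + sqNorm (mixedDeriv 1 0 u) + sqNorm (mixedDeriv 0 1 u) + sqNorm u := by
  unfold sqNorm
  simp only [← sqInt_add]
  simp only [formC, partialDeriv_toFun, sqInt]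
  congr 1
  funext p
  simp [toFun]

lemma formB_toFun (u : MvPolynomial (Fin 2) ℝ) :
    formB (toFun u) = formC (toFun u) + (sqNorm (mixedDeriv 1 1 u)
      + sqNorm (mixedDeriv 2 1 u) + sqNorm (mixedDeriv 1 2 u) + sqNorm (mixedDeriv 3 1 u)
      + sqNorm (mixedDeriv 1 3 u) + sqNorm (mixedDeriv 2 2 u)) := by
  rw [formC_toFun]
  unfold sqNorm
  simp only [← sqInt_add]
  simp only [formB, partialDeriv_toFun, sqInt]
  congr 1
  funext p
  have : mixedDeriv 0 0 u = u := rfl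
  simp [toFun, multiIndices, Finset.sum_filter, Finset.sum_product, Finset.sum_range_succ, this]
  ring

/-- The mixed derivatives of order four are estimated through each other, starting from the pure
ones; those of order three then follow by interpolation. -/
lemma exists_formB_le : ∃ M : ℝ, 0 < M ∧ ∀ u : MvPolynomial (Fin 2) ℝ,
    formB (toFun u) ≤ M * formC (toFun u) := by
  obtain ⟨K, hK, hmix⟩ := exists_sqNorm_mixed_le
  obtain ⟨m, hm⟩ : ∃ m : ℝ, m = 16 * K ^ 2 + 32 * K ^ 4 + 1 := ⟨_, rfl⟩
  have hm0 : 0 < m := by rw [hm]; positivity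
  obtain ⟨q, hq⟩ : ∃ q : ℝ, q = K * (8 * K ^ 2 + (1 + m) / (4 * K ^ 2)) := ⟨_, rfl⟩
  have hq0 : 0 < q := by rw [hq]; positivity
  refine ⟨1 + 4 * K + 2 * (10000000 + m) + 2 * q + m, by positivity, fun u => ?_⟩
  rw [formB_toFun]
  obtain ⟨D, hD⟩ : ∃ D, D = formC (toFun u) := ⟨_, rfl⟩
  rw [← hD]
  rw [formC_toFun] at hD
  have n40 := sqNorm_nonneg (mixedDeriv 4 0 u)
  have n04 := sqNorm_nonneg (mixedDeriv 0 4 u)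
  have n30 := sqNorm_nonneg (mixedDeriv 3 0 u)
  have n03 := sqNorm_nonneg (mixedDeriv 0 3 u)
  have n20 := sqNorm_nonneg (mixedDeriv 2 0 u)
  have n02 := sqNorm_nonneg (mixedDeriv 0 2 u)
  have n10 := sqNorm_nonneg (mixedDeriv 1 0 u)
  have n01 := sqNorm_nonneg (mixedDeriv 0 1 u)
  have n00 := sqNorm_nonneg u
  -- The derivatives that occur, as second derivatives of derivatives of lower order.
  have d11 : mixedDeriv 1 1 u = pderiv 0 (pderiv 1 u) :=
    (mixedDeriv_succ_left 0 1 u).trans (congrArg _ (mixedDeriv_succ_right 0 0 u))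
  have d20 : mixedDeriv 2 0 u = pderiv 0 (pderiv 0 u) :=
    (mixedDeriv_succ_left 1 0 u).trans (congrArg _ (mixedDeriv_succ_left 0 0 u))
  have d02 : mixedDeriv 0 2 u = pderiv 1 (pderiv 1 u) :=
    (mixedDeriv_succ_right 0 1 u).trans (congrArg _ (mixedDeriv_succ_right 0 0 u))
  have d31 : mixedDeriv 3 1 u = pderiv 0 (pderiv 1 (mixedDeriv 2 0 u)) :=
    (mixedDeriv_succ_left 2 1 u).trans (congrArg _ (mixedDeriv_succ_right 2 0 u))
  have d13 : mixedDeriv 1 3 u = pderiv 0 (pderiv 1 (mixedDeriv 0 2 u)) :=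
    (mixedDeriv_succ_left 0 3 u).trans (congrArg _ (mixedDeriv_succ_right 0 2 u))
  have d22 : mixedDeriv 2 2 u = pderiv 0 (pderiv 1 (mixedDeriv 1 1 u)) :=
    (mixedDeriv_succ_left 1 2 u).trans (congrArg _ (mixedDeriv_succ_right 1 1 u))
  have d22' : mixedDeriv 2 2 u = pderiv 1 (pderiv 1 (mixedDeriv 2 0 u)) :=
    (mixedDeriv_succ_right 2 1 u).trans (congrArg _ (mixedDeriv_succ_right 2 0 u))
  have d22'' : mixedDeriv 2 2 u = pderiv 0 (pderiv 0 (mixedDeriv 0 2 u)) :=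
    (mixedDeriv_succ_left 1 2 u).trans (congrArg _ (mixedDeriv_succ_left 0 2 u))
  have d40 : mixedDeriv 4 0 u = pderiv 0 (pderiv 0 (mixedDeriv 2 0 u)) :=
    (mixedDeriv_succ_left 3 0 u).trans (congrArg _ (mixedDeriv_succ_left 2 0 u))
  have d04 : mixedDeriv 0 4 u = pderiv 1 (pderiv 1 (mixedDeriv 0 2 u)) :=
    (mixedDeriv_succ_right 0 3 u).trans (congrArg _ (mixedDeriv_succ_right 0 2 u))
  have d31' : mixedDeriv 3 1 u = pderiv 0 (pderiv 0 (mixedDeriv 1 1 u)) :=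
    (mixedDeriv_succ_left 2 1 u).trans (congrArg _ (mixedDeriv_succ_left 1 1 u))
  have d13' : mixedDeriv 1 3 u = pderiv 1 (pderiv 1 (mixedDeriv 1 1 u)) :=
    (mixedDeriv_succ_right 1 2 u).trans (congrArg _ (mixedDeriv_succ_right 1 1 u))
  have d21 : mixedDeriv 2 1 u = pderiv 1 (mixedDeriv 2 0 u) := mixedDeriv_succ_right 2 0 u
  have d12 : mixedDeriv 1 2 u = pderiv 0 (mixedDeriv 0 2 u) := mixedDeriv_succ_left 0 2 u
  have b11 : sqNorm (mixedDeriv 1 1 u) ≤ 4 * K * D := by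
    have h := hmix u 1 one_pos
    rw [← d11, ← d20, ← d02] at h
    refine h.trans ?_
    rw [mul_comm 4 K, mul_assoc]
    exact mul_le_mul_of_nonneg_left (by rw [inv_one]; linarith) hK.le
  -- The parameter makes the coefficient of the `(2, 2)` term equal to `1 / 2` below.
  have hδ : 0 < 4 * K ^ 2 := by positivity
  have b31 : sqNorm (mixedDeriv 3 1 u)
      ≤ K * (8 * K ^ 2 * D + (4 * K ^ 2)⁻¹ * (D + sqNorm (mixedDeriv 2 2 u))) := by
    have h := hmix (mixedDeriv 2 0 u) _ hδ
    rw [← d31, ← d40, ← d22'] at h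
    refine h.trans (mul_le_mul_of_nonneg_left (add_le_add ?_ ?_) hK.le)
    · have := mul_le_mul_of_nonneg_left
        (show sqNorm (mixedDeriv 2 0 u) + sqNorm (mixedDeriv 4 0 u) ≤ 2 * D by linarith) hδ.le
      linarith
    · exact mul_le_mul_of_nonneg_left (by linarith) (inv_pos.2 hδ).le
  have b13 : sqNorm (mixedDeriv 1 3 u)
      ≤ K * (8 * K ^ 2 * D + (4 * K ^ 2)⁻¹ * (D + sqNorm (mixedDeriv 2 2 u))) := by
    have h := hmix (mixedDeriv 0 2 u) _ (inv_pos.2 hδ)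
    rw [← d13, ← d04, ← d22'', inv_inv, add_comm] at h
    refine h.trans (mul_le_mul_of_nonneg_left (add_le_add ?_ ?_) hK.le)
    · have := mul_le_mul_of_nonneg_left
        (show sqNorm (mixedDeriv 0 2 u) + sqNorm (mixedDeriv 0 4 u) ≤ 2 * D by linarith) hδ.le
      linarith
    · exact mul_le_mul_of_nonneg_left (by linarith) (inv_pos.2 hδ).le
  have b22 : sqNorm (mixedDeriv 2 2 u) ≤ m * D := by
    have h := hmix (mixedDeriv 1 1 u) 1 one_pos
    rw [← d22, ← d31', ← d13', inv_one] at h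
    have h' : sqNorm (mixedDeriv 2 2 u)
        ≤ K * (2 * (4 * K * D) + 2 * (K * (8 * K ^ 2 * D
          + (4 * K ^ 2)⁻¹ * (D + sqNorm (mixedDeriv 2 2 u))))) :=
      h.trans (mul_le_mul_of_nonneg_left (by linarith) hK.le)
    have h'' : K * (2 * (4 * K * D) + 2 * (K * (8 * K ^ 2 * D
          + (4 * K ^ 2)⁻¹ * (D + sqNorm (mixedDeriv 2 2 u)))))
        = 8 * K ^ 2 * D + 16 * K ^ 4 * D + (D + sqNorm (mixedDeriv 2 2 u)) / 2 := by
      field_simp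
      ring
    rw [h''] at h'
    rw [hm]
    linarith
  have b21 := sqNorm_pderiv_le 1 (mixedDeriv 2 0 u)
  have b12 := sqNorm_pderiv_le 0 (mixedDeriv 0 2 u)
  rw [← d22', ← d21] at b21
  rw [← d22'', ← d12] at b12
  have e22 : D + sqNorm (mixedDeriv 2 2 u) ≤ (1 + m) * D := by linarith
  have c3 : K * (8 * K ^ 2 * D + (4 * K ^ 2)⁻¹ * (D + sqNorm (mixedDeriv 2 2 u))) ≤ q * D :=
    calc K * (8 * K ^ 2 * D + (4 * K ^ 2)⁻¹ * (D + sqNorm (mixedDeriv 2 2 u)))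
        ≤ K * (8 * K ^ 2 * D + (4 * K ^ 2)⁻¹ * ((1 + m) * D)) := by gcongr
      _ = q * D := by rw [hq]; ring
  have e31 := b31.trans c3
  have e13 := b13.trans c3
  have e21 : sqNorm (mixedDeriv 2 1 u) ≤ (10000000 + m) * D := by linarith
  have e12 : sqNorm (mixedDeriv 1 2 u) ≤ (10000000 + m) * D := by linarith
  linarith

end SpectralForms

theorem theorem2p1 :
    ∃ M : ℝ, 0 < M ∧
      ∀ (W : ℕ) (u : MvPolynomial (Fin 2) ℝ),
        (∀ i : Fin 2, u.degreeOf i ≤ W) →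
          (1 / M) * SpectralForms.formB (SpectralForms.toFun u)
              ≤ SpectralForms.formC (SpectralForms.toFun u) ∧
            SpectralForms.formC (SpectralForms.toFun u)
              ≤ SpectralForms.formB (SpectralForms.toFun u) := by
  obtain ⟨M, hM, h⟩ := SpectralForms.exists_formB_le
  refine ⟨M, hM, fun _ u _ => ⟨?_, ?_⟩⟩
  · rw [one_div, inv_mul_le_iff₀ hM]
    exact h u
  · rw [SpectralForms.formB_toFun]
    have hn := fun i j => SpectralForms.sqNorm_nonneg (SpectralForms.mixedDeriv i j u)
    linarith [hn 1 1, hn 2 1, hn 1 2, hn 3 1, hn 1 3, hn 2 2]
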